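/- Let $\Omega\subset\mathbb R^2$ be a bounded Lipschitz domain, $f\in L^2(\Omega)$, and let $\mathcal T_0$ be a regular triangulation of $\Omega$ into finitely many closed triangles (two distinct triangles are disjoint or share exactly one vertex or exactly one side). Each triangle is an ordered triple $(P_1,P_2,P_3)$ of its vertices with refinement edge $P_1P_3$; its newest-vertex bisection has the children $(P_1,M,P_2)$ and $(P_3,M,P_2)$ with $M=(P_1+P_3)/2$. For a regular triangulation $\mathcal S$ let $\mathbb T(\mathcal S)$ be the set of all regular triangulations obtained from $\mathcal S$ by finitely many successive bisections of single triangles (intermediate partitions need not be regular). For a regular triangulation $\mathcal T$ let $\mathcal E(K)$ be the set of the three sides of $K\in\mathcal T$, let $CR^1_0(\mathcal T)$ be the space of all piecewise affine functions with respect to $\mathcal T$ that are continuous at the midpoints of interior sides and vanish at the midpoints of boundary sides, let $\nabla_{NC}$ be the piecewise gradient, and let $u_{CR}\in CR^1_0(\mathcal T)$ solve $$\int_\Omega \nabla_{NC}u_{CR}\cdot\nabla_{NC}v\,dx=\int_\Omega f\,v\,dx\qquad\text{for all }v\in CR^1_0(\mathcal T).$$ For a side $E$ let $[\partial u_{CR}/\partial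 s]_E$ be the jump across $E$ of the derivative of $u_{CR}$ along $E$ if $E$ is interior, and this derivative itself if $E\subset\partial\Omega$. Define, for $K\in\mathcal T$ and $\mathcal U\subseteq\mathcal T$, $$\eta^2(\mathcal T,K)=|K|\,\|f\|_{L^2(K)}^2+|K|^{1/2}\sum_{E\in\mathcal E(K)}\big\|[\partial u_{CR}/\partial s]_E\big\|_{L^2(E)}^2,\qquad \eta(\mathcal T,\mathcal U)=\Big(\sum_{K\in\mathcal U}\eta^2(\mathcal T,K)\Big)^{1/2},$$ and $c_{\rm quot}(\mathcal T)=\max\{|K_1|/|K_2| : K_1,K_2\in\mathcal T,\ \mathcal E(K_1)\cap\mathcal E(K_2)\ne\emptyset\}$. **Theorem (stability (A1) for the Crouzeix–Raviart FEM).** Let $\mathcal T\in\mathbb T(\mathcal T_0)$ and $\hat{\mathcal T}\in\mathbb T(\mathcal T)$, and let $\omega_0>0$ be a lower bound of all interior angles of the triangles in $\mathcal T$ and $\hat{\mathcal T}$. Then $c_{\rm quot}(\mathcal T)$ and $c_{\rm quot}(\hat{\mathcal T})$ are at most $2\cot(\omega_0)/\sin(\omega_0)$, and the Crouzeix–Raviart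 solutions $u_{CR}$ and $\hat u_{CR}$ with respect to $\mathcal T$ and $\hat{\mathcal T}$ satisfy $$\big|\eta(\mathcal T,\mathcal T\cap\hat{\mathcal T})-\eta(\hat{\mathcal T},\mathcal T\cap\hat{\mathcal T})\big|\le\Lambda_1\,\|\nabla_{NC}(u_{CR}-\hat u_{CR})\|_{L^2(\Omega)},\qquad \Lambda_1^2=48\cot(\omega_0)\,(2\sin(\omega_0))^{-1/2}.$$ -/

import Mathlib

open MeasureTheory

noncomputable section

namespace CRStab

/-- The Euclidean plane, with its Euclidean norm and Lebesgue measure. -/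
abbrev Plane := EuclideanSpace ℝ (Fin 2)

/-- A triangle `(P₁, P₂, P₃) = (K 0, K 1, K 2)`, given by the ordered tuple of its vertices. The
order encodes the refinement edge `P₁P₃`. Nondegeneracy is required in a triangulation. -/
abbrev Triangle := Fin 3 → Plane

namespace Triangle

/-- The closed triangle as a set of points. -/
def body (K : Triangle) : Set Plane := convexHull ℝ (Set.range K)

/-- The area `|K|`. -/
def area (K : Triangle) : ℝ := volume.real K.body

/-- The interior angle at the vertex `K i`. -/
def angle (K : Triangle) (i : Fin 3) : ℝ :=
  EuclideanGeometry.angle (K (i + 1)) (K i) (K (i + 2))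

/-- The side of `K` opposite to the vertex `K i`; the three sides form `ℰ(K)`. -/
def side (K : Triangle) (i : Fin 3) : Set Plane := segment ℝ (K (i + 1)) (K (i + 2))

/-- The midpoint of the `i`-th side. -/
def mid (K : Triangle) (i : Fin 3) : Plane := midpoint ℝ (K (i + 1)) (K (i + 2))

/-- A unit tangent vector of the `i`-th side. -/
def tangent (K : Triangle) (i : Fin 3) : Plane :=
  (dist (K (i + 1)) (K (i + 2)))⁻¹ • (K (i + 2) - K (i + 1))

/-- The first child `(P₁, (P₁ + P₃)/2, P₂)` of the newest-vertex bisection of `(P₁, P₂, P₃)`. -/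
def child₁ (K : Triangle) : Triangle := ![K 0, midpoint ℝ (K 0) (K 2), K 1]

/-- The second child `(P₃, (P₁ + P₃)/2, P₂)` of the newest-vertex bisection. -/
def child₂ (K : Triangle) : Triangle := ![K 2, midpoint ℝ (K 0) (K 2), K 1]

end Triangle

/-- A bounded Lipschitz domain in the plane: open, connected, non-empty, bounded, and near every
boundary point the strict epigraph of a Lipschitz function in suitable Cartesian coordinates. -/
structure IsLipschitzDomain (Ω : Set Plane) : Prop where
  isOpen : IsOpen Ω
  isConnected : IsConnected Ω
  isBounded : Bornology.IsBounded Ω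
  lipschitz_boundary : ∀ x ∈ frontier Ω, ∃ (e : Plane ≃ᵃⁱ[ℝ] Plane) (r : ℝ) (L : NNReal)
    (φ : ℝ → ℝ), 0 < r ∧ LipschitzWith L φ ∧
      ∀ y ∈ Metric.ball x r, y ∈ Ω ↔ φ (e y 0) < e y 1

/-- `T` is a regular triangulation of `Ω`: finitely many nondegenerate closed triangles that cover
the closure of `Ω`, and two distinct ones are disjoint or share exactly a common vertex or
a common side. (In particular the boundary of `Ω` is polygonal.) -/
structure IsRegularTriangulation (Ω : Set Plane) (T : Finset Triangle) : Prop where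
  nondegenerate : ∀ K ∈ T, AffineIndependent ℝ K
  cover : ⋃ K ∈ T, K.body = closure Ω
  conforming : ∀ K ∈ T, ∀ K' ∈ T, K ≠ K' → Set.range K ≠ Set.range K' ∧
    K.body ∩ K'.body = convexHull ℝ (Set.range K ∩ Set.range K')

open Classical in
/-- `T'` results from `T` by the bisection of one triangle. -/
def BisectStep (T T' : Finset Triangle) : Prop :=
  ∃ K ∈ T, T' = T.erase K ∪ {K.child₁, K.child₂}

/-- `𝕋(T₀)`: all regular triangulations obtained from `T₀` by finitely many successive bisections
(the intermediate partitions may have hanging nodes). -/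
def admissible (Ω : Set Plane) (T₀ : Finset Triangle) : Set (Finset Triangle) :=
  {T | Relation.ReflTransGen BisectStep T₀ T ∧ IsRegularTriangulation Ω T}

open Classical in
/-- The unrefined triangles `T ∩ T'`. -/
def unrefined (T T' : Finset Triangle) : Finset Triangle := T ∩ T'

open Classical in
/-- The triangles of `T` other than `K` that share the `i`-th side of `K`. In a regular
triangulation there is exactly one of them if the side is interior and none if it lies on the
boundary. -/
def neighbours (T : Finset Triangle) (K : Triangle) (i : Fin 3) : Finset Triangle :=
  {K' ∈ T | K' ≠ K ∧ ∃ j, K'.side j = K.side i}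

/-- The maximal quotient of the areas of two triangles of `T` with a common side (the maximum of a
finite set). -/
def cQuot (T : Finset Triangle) : ℝ :=
  sSup {q | ∃ K₁ ∈ T, ∃ K₂ ∈ T, (∃ i j, K₁.side i = K₂.side j) ∧ q = K₁.area / K₂.area}

/-- Piecewise affine functions: `v K` is the affine function that represents `v` on `K`, and
an element of `P₁(T)` is given by the `v K` with `K ∈ T` (the others play no role). -/
abbrev PiecewiseAffine := Triangle → (Plane →ᵃ[ℝ] ℝ)

/-- The function on the plane described by `v ∈ P₁(T)` (zero on the null set of all sides). -/
def pwValue (T : Finset Triangle) (v : PiecewiseAffine) (x : Plane) : ℝ :=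
  ∑ K ∈ T, (interior K.body).indicator (fun y => v K y) x

/-- The piecewise gradient `∇_NC v` of `v ∈ P₁(T)`. -/
def pwGrad (T : Finset Triangle) (v : PiecewiseAffine) (x : Plane) : Plane :=
  ∑ K ∈ T, (interior K.body).indicator (fun y => gradient (v K) y) x

/-- The Crouzeix–Raviart space `CR¹₀(T)`: continuity at the midpoints of interior sides, and zero at
the midpoints of boundary sides. -/
def CR₀ (T : Finset Triangle) : Set PiecewiseAffine :=
  {v | ∀ K ∈ T, ∀ i, (∀ K' ∈ neighbours T K i, v K (K.mid i) = v K' (K.mid i)) ∧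
    (neighbours T K i = ∅ → v K (K.mid i) = 0)}

/-- `u` is a Crouzeix–Raviart solution: `a_NC(u, v) = (f, v)` in `L²(Ω)` for all `v ∈ CR¹₀(T)`. -/
def IsCRSolution (Ω : Set Plane) (f : Plane → ℝ) (T : Finset Triangle) (u : PiecewiseAffine) :
    Prop :=
  u ∈ CR₀ T ∧ ∀ v ∈ CR₀ T,
    (∫ x in Ω, inner ℝ (pwGrad T u x) (pwGrad T v x)) = ∫ x in Ω, f x * pwValue T v x

/-- The jump `[∂u/∂s]` of the tangential derivative across the `i`-th side of `K ∈ T`: the value from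
`K` minus the value from the neighbour, where there is one, and the value from `K` itself on
a boundary side. -/
def tangentialJump (T : Finset Triangle) (u : PiecewiseAffine) (K : Triangle) (i : Fin 3)
    (x : Plane) : ℝ :=
  inner ℝ (gradient (u K) x) (K.tangent i) -
    ∑ K' ∈ neighbours T K i, inner ℝ (gradient (u K') x) (K.tangent i)

/-- The local estimator
`η²(T, K) = |K| ‖f‖²_{L²(K)} + |K|^{1/2} ∑_{E ∈ ℰ(K)} ‖[∂u/∂s]‖²_{L²(E)}`. -/
def etaSq (f : Plane → ℝ) (T : Finset Triangle) (u : PiecewiseAffine) (K : Triangle) : ℝ :=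
  K.area * (∫ x in K.body, f x ^ 2) +
    √K.area * ∑ i, (∫ x in K.side i, tangentialJump T u K i x ^ 2 ∂(Measure.hausdorffMeasure 1))

/-- `η(T, U) = (∑_{K ∈ U} η²(T, K))^{1/2}` for `U ⊆ T`. -/
def eta (f : Plane → ℝ) (T : Finset Triangle) (u : PiecewiseAffine) (U : Finset Triangle) : ℝ :=
  √(∑ K ∈ U, etaSq f T u K)

/-- The distance `δ(T, T') = ‖∇_NC (u - u')‖_{L²(Ω)}` of `u ∈ P₁(T)` and `u' ∈ P₁(T')`. -/
def delta (Ω : Set Plane) (T T' : Finset Triangle) (u u' : PiecewiseAffine) : ℝ :=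
  √(∫ x in Ω, ‖pwGrad T u x - pwGrad T' u' x‖ ^ 2)

/-- The constant `Λ₁`, with `Λ₁² = 48 cot(ω₀) (2 sin(ω₀))^{-1/2}`. -/
def Lambda₁ (ω₀ : ℝ) : ℝ := √(48 * Real.cot ω₀ * (2 * Real.sin ω₀) ^ (-(1 / 2 : ℝ)))

end CRStab

end

/-! ### Signed areas and the area formula -/

namespace CRStab

/-! On a common triangle the volume terms of both estimators agree, so the reverse triangle
inequality in `ℓ²` leaves only differences of tangential jumps (`abs_eta_sub_eta_le`). Let `K` be
unrefined with a side `E`. If `E` is interior, its fine neighbour `K'` lies inside its coarse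
neighbour, since refinement only subdivides; otherwise `E` is a boundary side of both
triangulations. Hence the jump difference across `E` is the tangential part of the difference of the
values of `∇_NC (u - u')` on `K` and `K'`, and its square is at most twice the sum of the squared
norms of these values (`tangentialJump_sub_sq_le`).

The angle bound gives `2 sin ω |K| ≤ |E|²` and `|E|² ≤ 4 cot ω |K'|` for triangles at `E`. Their
quotient bounds `c_quot`; combined, they give `|K|^{1/2} |E| ≤ C |K'|` with `C = 4 cot ω (2 sin
ω)^{-1/2}`. In the sum over all sides, each fine triangle occurs three times as itself and at most
three times as a neighbour, so `Λ₁² = 2 (3 + 3) C`. -/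

/-- Twice the signed area of the triangle with vertices `a`, `b`, `c`. -/
def cross (a b c : Plane) : ℝ := (b 0 - a 0) * (c 1 - a 1) - (b 1 - a 1) * (c 0 - a 0)

theorem cross_swap (a b c : Plane) : cross b a c = -cross a b c := by
  unfold cross; ring

theorem cross_combo (a b c : Plane) {x y z : ℝ} (h : x + y + z = 1) :
    cross a b (x • a + y • b + z • c) = z * cross a b c := by
  obtain rfl : x = 1 - y - z := by linarith
  simp only [cross, PiLp.add_apply, PiLp.smul_apply, smul_eq_mul]
  ring

theorem cross_eq_zero_of_mem_segment {a b p : Plane} (h : p ∈ segment ℝ a b) :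
    cross a b p = 0 := by
  obtain ⟨x, y, -, -, hxy, rfl⟩ := h
  have := cross_combo a b a (x := x) (y := y) (z := 0) (by linarith)
  simpa using this

theorem cross_midpoint (a b c : Plane) : cross b c (midpoint ℝ a b) = cross a b c / 2 := by
  rw [midpoint_eq_smul_add]
  simp only [cross, PiLp.add_apply, PiLp.smul_apply, smul_eq_mul, invOf_eq_inv]
  ring

theorem combo_mem_convexHull {s : Set Plane} {a b c : Plane} (ha : a ∈ s) (hb : b ∈ s)
    (hc : c ∈ s) {x y z : ℝ} (hx : 0 ≤ x) (hy : 0 ≤ y) (hz : 0 ≤ z) (h : x + y + z = 1) :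
    x • a + y • b + z • c ∈ convexHull ℝ s := by
  have hs := subset_convexHull ℝ s
  have := (convex_convexHull ℝ s).sum_mem (t := Finset.univ) (w := ![x, y, z]) (z := ![a, b, c])
    (by intro i _; fin_cases i <;> simpa) (by simpa [Fin.sum_univ_three] using h)
    (by intro i _; fin_cases i <;> simp <;> apply hs <;> assumption)
  simpa [Fin.sum_univ_three] using this

/-- The unit triangle has area `1 / 2`. -/
theorem volume_unit_triangle :
    volume.real (convexHull ℝ (Set.range ![0, EuclideanSpace.single 0 1,
      EuclideanSpace.single 1 1] : Set Plane)) = 1 / 2 := by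
  set e : Triangle := ![0, EuclideanSpace.single 0 1, EuclideanSpace.single 1 1] with he
  set S : Set (ℝ × ℝ) := {p | p.1 ∈ Set.Icc (0 : ℝ) 1 ∧ p.2 ∈ Set.Icc 0 (1 - p.1)} with hS
  let φ : Plane ≃ᵐ ℝ × ℝ :=
    (MeasurableEquiv.toLp 2 (Fin 2 → ℝ)).symm.trans MeasurableEquiv.finTwoArrow
  have hφ : MeasurePreserving φ volume volume :=
    (EuclideanSpace.volume_preserving_symm_measurableEquiv_toLp (Fin 2)).trans
      (volume_preserving_finTwoArrow ℝ)
  have hφ' : ∀ p, φ p = (p 0, p 1) := fun p => rfl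
  have hpre : convexHull ℝ (Set.range e) = φ ⁻¹' S := by
    apply Set.Subset.antisymm
    · apply convexHull_min
      · rintro _ ⟨i, rfl⟩
        fin_cases i <;> simp [he, hS, hφ']
      · rintro p hp q hq a b ha hb hab
        simp only [hS, hφ', Set.mem_preimage, Set.mem_ofPred_eq, Set.mem_Icc, PiLp.add_apply,
          PiLp.smul_apply, smul_eq_mul] at hp hq ⊢
        obtain rfl : b = 1 - a := by linarith
        obtain ⟨⟨h1, h2⟩, h3, h4⟩ := hp
        obtain ⟨⟨k1, k2⟩, k3, k4⟩ := hq
        refine ⟨⟨?_, ?_⟩, ?_, ?_⟩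
        · positivity
        · nlinarith
        · positivity
        · nlinarith
    · intro p hp
      simp only [hS, hφ', Set.mem_preimage, Set.mem_ofPred_eq, Set.mem_Icc] at hp
      have := combo_mem_convexHull (Set.mem_range_self (f := e) 0) (Set.mem_range_self 1)
        (Set.mem_range_self 2) (x := 1 - p 0 - p 1) (by linarith) hp.1.1 hp.2.1 (by ring)
      convert this
      ext i
      fin_cases i <;> simp [he]
  have hSm : MeasurableSet S := by
    apply measurableSet_region_between_cc measurable_const (by fun_prop) measurableSet_Icc
  rw [hpre, measureReal_def, hφ.measure_preimage hSm.nullMeasurableSet,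
    Measure.volume_eq_prod, Measure.prod_apply hSm]
  have : ∀ x : ℝ, volume (Prod.mk x ⁻¹' S) =
      (Set.Icc (0 : ℝ) 1).indicator (fun x => ENNReal.ofReal (1 - x)) x := by
    intro x
    by_cases hx : x ∈ Set.Icc (0 : ℝ) 1
    · have : Prod.mk x ⁻¹' S = Set.Icc 0 (1 - x) := by
        ext y; simp only [hS, Set.mem_preimage, Set.mem_ofPred_eq]; tauto
      rw [this, Set.indicator_of_mem hx, Real.volume_Icc, sub_zero]
    · have : Prod.mk x ⁻¹' S = ∅ := by
        ext y; simp only [hS, Set.mem_preimage, Set.mem_ofPred_eq]; tauto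
      rw [this, Set.indicator_of_notMem hx, measure_empty]
  simp_rw [this]
  rw [lintegral_indicator measurableSet_Icc, ← ofReal_integral_eq_lintegral_ofReal,
    integral_Icc_eq_integral_Ioc, ← intervalIntegral.integral_of_le zero_le_one,
    ENNReal.toReal_ofReal]
  · rw [intervalIntegral.integral_sub (by simp) (by simp)]; norm_num
  · exact intervalIntegral.integral_nonneg zero_le_one fun x hx => sub_nonneg.2 hx.2
  · exact (Continuous.continuousOn (by fun_prop)).integrableOn_Icc
  · filter_upwards [ae_restrict_mem measurableSet_Icc] with x hx
    simpa using hx.2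

namespace Triangle

/-- The triangle is a translate of the image of the unit triangle under the matrix with columns `K 1
- K 0` and `K 2 - K 0`, and the determinant scales the area. -/
theorem area_eq (K : Triangle) : K.area = |cross (K 0) (K 1) (K 2)| / 2 := by
  set A : Matrix (Fin 2) (Fin 2) ℝ :=
    !![K 1 0 - K 0 0, K 2 0 - K 0 0; K 1 1 - K 0 1, K 2 1 - K 0 1] with hA
  set l : Plane →ₗ[ℝ] Plane := Matrix.toEuclideanLin A with hl
  have hdet : LinearMap.det l = cross (K 0) (K 1) (K 2) := by
    have : LinearMap.det l = A.det := by
      rw [hl, Matrix.toEuclideanLin_eq_toLin_orthonormal, LinearMap.det_toLin]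
    rw [this, hA, Matrix.det_fin_two_of, cross]; ring
  set e : Triangle := ![0, EuclideanSpace.single 0 1, EuclideanSpace.single 1 1] with he
  have hbody : K.body = (fun x => K 0 + x) '' (l '' convexHull ℝ (Set.range e)) := by
    rw [l.image_convexHull, ← Set.range_comp]
    have h2 := (AffineEquiv.constVAdd ℝ Plane (K 0)).toAffineMap.image_convexHull
      (Set.range (l ∘ e))
    have h3 : ⇑(AffineEquiv.constVAdd ℝ Plane (K 0)).toAffineMap = fun x => K 0 + x := rfl
    rw [h3] at h2
    rw [h2, ← Set.range_comp, body]
    congr 2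
    ext i j
    fin_cases i <;> fin_cases j <;>
      simp [he, hl, hA, Matrix.toLpLin_apply]
  rw [area, hbody, measureReal_def, Set.image_add_left, measure_preimage_add,
    Measure.addHaar_image_linearMap, hdet, ENNReal.toReal_mul, ENNReal.toReal_ofReal (abs_nonneg _),
    ← measureReal_def, volume_unit_triangle]
  ring

theorem cross_rotate (K : Triangle) (i : Fin 3) :
    cross (K (i + 1)) (K (i + 2)) (K i) = cross (K 0) (K 1) (K 2) := by
  fin_cases i <;> simp [cross] <;> ring

theorem cross_ne_zero {K : Triangle} (hK : AffineIndependent ℝ K) (i : Fin 3) :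
    cross (K (i + 1)) (K (i + 2)) (K i) ≠ 0 := by
  rw [cross_rotate]
  intro h
  rw [affineIndependent_iff_linearIndependent_vsub ℝ _ (0 : Fin 3)] at hK
  have hp := hK.comp ![⟨1, by decide⟩, ⟨2, by decide⟩] (by
    intro a b; fin_cases a <;> fin_cases b <;> simp)
  have h2 : LinearIndependent ℝ ![K 1 - K 0, K 2 - K 0] := by
    convert! hp using 1
    ext i; fin_cases i <;> rfl
  rw [LinearIndependent.pair_iff] at h2
  unfold cross at h
  -- A vanishing determinant makes these coefficients linear relations between the edge vectors;
  -- independence then annihilates both coordinates of `K 1 - K 0`.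
  have a1 := h2 (K 2 1 - K 0 1) (-(K 1 1 - K 0 1)) (by
    ext j; fin_cases j <;> simp <;> linarith)
  have a2 := h2 (K 2 0 - K 0 0) (-(K 1 0 - K 0 0)) (by
    ext j; fin_cases j <;> simp <;> linarith)
  have a3 := h2 1 0 (by
    ext j; fin_cases j <;> simp <;> linarith [a1.2, a2.2])
  exact one_ne_zero a3.1

theorem area_pos {K : Triangle} (hK : AffineIndependent ℝ K) : 0 < K.area := by
  have := cross_ne_zero hK 0
  rw [cross_rotate] at this
  rw [area_eq]
  positivity

theorem range_eq (K : Triangle) (i : Fin 3) : Set.range K = {K (i + 1), K (i + 2), K i} := by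
  ext p
  simp only [Set.mem_range, Set.mem_insert_iff, Set.mem_singleton_iff, Fin.exists_fin_succ]
  fin_cases i <;> simp [eq_comm] <;> tauto

theorem two_area_eq (K : Triangle) (i : Fin 3) :
    2 * K.area = Real.sin (K.angle i) * (dist (K (i + 1)) (K i) * dist (K (i + 2)) (K i)) := by
  rw [angle, EuclideanGeometry.angle, dist_eq_norm, dist_eq_norm, vsub_eq_sub, vsub_eq_sub,
    InnerProductGeometry.sin_angle_mul_norm_mul_norm, area_eq, ← cross_rotate K i]
  rw [mul_div_cancel₀ _ two_ne_zero, ← Real.sqrt_sq_eq_abs]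
  congr 1
  simp only [PiLp.inner_apply, Fin.sum_univ_two, cross, PiLp.sub_apply, RCLike.inner_apply,
    conj_trivial]
  ring

theorem inner_eq (K : Triangle) (i : Fin 3) :
    inner ℝ (K (i + 1) - K i) (K (i + 2) - K i) =
      Real.cos (K.angle i) * (dist (K (i + 1)) (K i) * dist (K (i + 2)) (K i)) := by
  rw [angle, EuclideanGeometry.angle, dist_eq_norm, dist_eq_norm, vsub_eq_sub, vsub_eq_sub,
    InnerProductGeometry.cos_angle_mul_norm_mul_norm]

end Triangle
end CRStab

/-! ### Areas and side lengths under a minimal angle -/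

namespace CRStab
namespace Triangle

theorem dist_pos {K : Triangle} (hK : AffineIndependent ℝ K) {i j : Fin 3} (h : i ≠ j) :
    0 < dist (K i) (K j) :=
  _root_.dist_pos.2 (hK.injective.ne h)

theorem sin_angle_pos {K : Triangle} (hK : AffineIndependent ℝ K) (i : Fin 3) :
    0 < Real.sin (K.angle i) := by
  have h := two_area_eq K i
  have h1 := area_pos hK
  by_contra! h2
  have : 0 ≤ dist (K (i + 1)) (K i) * dist (K (i + 2)) (K i) := by positivity
  nlinarith

theorem angle_lt_pi {K : Triangle} (hK : AffineIndependent ℝ K) (i : Fin 3) :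
    K.angle i < Real.pi := by
  refine lt_of_le_of_ne (EuclideanGeometry.angle_le_pi _ _ _) fun h => ?_
  have := sin_angle_pos hK i
  rw [h, Real.sin_pi] at this
  exact lt_irrefl _ this

theorem sin_pos_of_le_angle {K : Triangle} (hK : AffineIndependent ℝ K) {ω : ℝ} (hω : 0 < ω)
    (h : ∀ i, ω ≤ K.angle i) : 0 < Real.sin ω :=
  Real.sin_pos_of_pos_of_lt_pi hω ((h 0).trans_lt (angle_lt_pi hK 0))

theorem inner_le_cot {K : Triangle} (hK : AffineIndependent ℝ K) {ω : ℝ} (hω : 0 < ω)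
    (h : ∀ i, ω ≤ K.angle i) (i : Fin 3) :
    inner ℝ (K (i + 1) - K i) (K (i + 2) - K i) ≤ Real.cot ω * (2 * K.area) := by
  have hs := sin_pos_of_le_angle hK hω h
  -- This is `0 ≤ sin (θ - ω)`, that is, monotonicity of the cotangent.
  have hcos : Real.cos (K.angle i) ≤ Real.cot ω * Real.sin (K.angle i) := by
    rw [Real.cot_eq_cos_div_sin, div_mul_eq_mul_div, le_div_iff₀ hs]
    have := Real.sin_nonneg_of_nonneg_of_le_pi (sub_nonneg.2 (h i))
      (by linarith [angle_lt_pi hK i])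
    rw [Real.sin_sub] at this
    linarith
  rw [inner_eq, two_area_eq K i, ← mul_assoc (Real.cot ω)]
  exact mul_le_mul_of_nonneg_right hcos (by positivity)

/-- Projecting the other two sides onto this one splits its squared length into the inner products
at its two endpoints, each at most `2 |K| cot ω`. -/
theorem dist_sq_le {K : Triangle} (hK : AffineIndependent ℝ K) {ω : ℝ} (hω : 0 < ω)
    (h : ∀ i, ω ≤ K.angle i) (i : Fin 3) :
    dist (K (i + 1)) (K (i + 2)) ^ 2 ≤ 4 * Real.cot ω * K.area := by
  have h1 := inner_le_cot hK hω h (i + 1)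
  have h2 := inner_le_cot hK hω h (i + 2)
  have e1 : i + 1 + 1 = i + 2 := by fin_cases i <;> rfl
  have e2 : i + 1 + 2 = i := by fin_cases i <;> rfl
  have e3 : i + 2 + 1 = i := by fin_cases i <;> rfl
  have e4 : i + 2 + 2 = i + 1 := by fin_cases i <;> rfl
  rw [e1, e2] at h1
  rw [e3, e4] at h2
  have : dist (K (i + 1)) (K (i + 2)) ^ 2 = inner ℝ (K (i + 2) - K (i + 1)) (K i - K (i + 1)) +
      inner ℝ (K i - K (i + 2)) (K (i + 1) - K (i + 2)) := by
    rw [dist_eq_norm, ← real_inner_self_eq_norm_sq]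
    simp only [PiLp.inner_apply, Fin.sum_univ_two, PiLp.sub_apply, RCLike.inner_apply,
      conj_trivial]
    ring
  linarith

/-- By the law of cosines `|E|² = (p - q)² + 2 p q (1 - cos θ)`, while `2 |K| = p q sin θ`; so `sin
ω sin θ ≤ 2 (1 - cos θ)` suffices. For acute `θ` use `sin ω ≤ sin θ`; for obtuse `θ` the right side
is at least 2. -/
theorem area_le {K : Triangle} (hK : AffineIndependent ℝ K) {ω : ℝ} (hω : 0 < ω)
    (h : ∀ i, ω ≤ K.angle i) (i : Fin 3) :
    2 * Real.sin ω * K.area ≤ dist (K (i + 1)) (K (i + 2)) ^ 2 := by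
  have hs := sin_pos_of_le_angle hK hω h
  set p := dist (K (i + 1)) (K i)
  set q := dist (K (i + 2)) (K i)
  have hp : 0 ≤ p := dist_nonneg
  have hq : 0 ≤ q := dist_nonneg
  set θ := K.angle i with hθ
  have hA : 2 * K.area = Real.sin θ * (p * q) := two_area_eq K i
  have hd : dist (K (i + 1)) (K (i + 2)) ^ 2 = p ^ 2 + q ^ 2 - 2 * (Real.cos θ * (p * q)) := by
    rw [hθ, ← inner_eq, dist_eq_norm, ← real_inner_self_eq_norm_sq]
    simp only [p, q, dist_eq_norm, ← real_inner_self_eq_norm_sq]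
    simp only [PiLp.inner_apply, Fin.sum_univ_two, PiLp.sub_apply, RCLike.inner_apply,
      conj_trivial]
    ring
  have key : Real.sin ω * Real.sin θ ≤ 2 * (1 - Real.cos θ) := by
    have hsθ := sin_angle_pos hK i
    rcases le_total θ (Real.pi / 2) with h1 | h1
    · have : Real.sin ω ≤ Real.sin θ :=
        Real.sin_le_sin_of_le_of_le_pi_div_two (by linarith [Real.pi_pos]) h1 (h i)
      nlinarith [Real.sin_sq_add_cos_sq θ, Real.cos_le_one θ]
    · have : Real.cos θ ≤ 0 := Real.cos_nonpos_of_pi_div_two_le_of_le h1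
        (by linarith [angle_lt_pi hK i, Real.pi_pos])
      nlinarith [Real.sin_le_one ω, Real.sin_le_one θ]
  nlinarith [mul_le_mul_of_nonneg_right key (mul_nonneg hp hq), sq_nonneg (p - q)]

theorem cot_pos_of_le_angle {K : Triangle} (hK : AffineIndependent ℝ K) {ω : ℝ} (hω : 0 < ω)
    (h : ∀ i, ω ≤ K.angle i) : 0 < Real.cot ω := by
  have h1 := dist_sq_le hK hω h 0
  have h2 := area_pos hK
  have h3 : 0 < dist (K (0 + 1)) (K (0 + 2)) := dist_pos hK (by decide)
  by_contra! h4
  nlinarith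

/-- Sides are compared as point sets; the diameter recovers the length whatever the order of the
endpoints. -/
theorem dist_eq_of_side_eq {K K' : Triangle} {i j : Fin 3} (h : K.side i = K'.side j) :
    dist (K (i + 1)) (K (i + 2)) = dist (K' (j + 1)) (K' (j + 2)) := by
  have := congrArg Metric.diam h
  simpa only [side, ← convexHull_pair, convexHull_diam, Metric.diam_pair] using this

theorem area_div_area_le {K₁ K₂ : Triangle} (h₁ : AffineIndependent ℝ K₁)
    (h₂ : AffineIndependent ℝ K₂) {ω : ℝ} (hω : 0 < ω) (hω₁ : ∀ i, ω ≤ K₁.angle i)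
    (hω₂ : ∀ i, ω ≤ K₂.angle i) {i j : Fin 3} (h : K₁.side i = K₂.side j) :
    K₁.area / K₂.area ≤ 2 * Real.cot ω / Real.sin ω := by
  have hs := sin_pos_of_le_angle h₁ hω hω₁
  rw [div_le_div_iff₀ (area_pos h₂) hs]
  have a1 := area_le h₁ hω hω₁ i
  have a2 := dist_sq_le h₂ hω hω₂ j
  rw [dist_eq_of_side_eq h] at a1
  linarith

/-- The weight of a side in the estimator, relative to the area of a triangle at that side. -/
theorem sqrt_area_mul_dist_div_area_le {K₁ K₂ : Triangle} (h₁ : AffineIndependent ℝ K₁)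
    (h₂ : AffineIndependent ℝ K₂) {ω : ℝ} (hω : 0 < ω) (hω₁ : ∀ i, ω ≤ K₁.angle i)
    (hω₂ : ∀ i, ω ≤ K₂.angle i) {i j : Fin 3} (h : K₁.side i = K₂.side j) :
    √K₁.area * dist (K₁ (i + 1)) (K₁ (i + 2)) / K₂.area ≤
      4 * Real.cot ω * (2 * Real.sin ω) ^ (-(1 / 2 : ℝ)) := by
  have hs := sin_pos_of_le_angle h₁ hω hω₁
  have a1 := area_le h₁ hω hω₁ i
  have a2 := dist_sq_le h₂ hω hω₂ j
  rw [← dist_eq_of_side_eq h] at a2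
  set d := dist (K₁ (i + 1)) (K₁ (i + 2)) with hd
  have hd0 : 0 ≤ d := dist_nonneg
  have hr : (2 * Real.sin ω) ^ (-(1 / 2 : ℝ)) = (√(2 * Real.sin ω))⁻¹ := by
    rw [Real.rpow_neg (by positivity), Real.sqrt_eq_rpow]
  have a3 : √(2 * Real.sin ω) * √K₁.area ≤ d := by
    rw [← Real.sqrt_mul (by positivity)]
    exact Real.sqrt_le_iff.2 ⟨hd0, a1⟩
  rw [hr, ← div_eq_mul_inv, div_le_div_iff₀ (area_pos h₂) (by positivity)]
  nlinarith [mul_le_mul_of_nonneg_right a3 hd0]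

end Triangle

theorem cQuot_le {T : Finset Triangle} (hne : T.Nonempty)
    (hT : ∀ K ∈ T, AffineIndependent ℝ K) {ω : ℝ} (hω : 0 < ω)
    (h : ∀ K ∈ T, ∀ i, ω ≤ K.angle i) : cQuot T ≤ 2 * Real.cot ω / Real.sin ω := by
  obtain ⟨K, hK⟩ := hne
  have hs := Triangle.sin_pos_of_le_angle (hT K hK) hω (h K hK)
  have hc := Triangle.cot_pos_of_le_angle (hT K hK) hω (h K hK)
  -- `Real.sSup_le` needs a nonnegative bound because the supremum of the empty set is 0.
  refine Real.sSup_le ?_ (by positivity)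
  rintro q ⟨K₁, h₁, K₂, h₂, ⟨i, j, hij⟩, rfl⟩
  exact Triangle.area_div_area_le (hT _ h₁) (hT _ h₂) hω (h _ h₁) (h _ h₂) hij

end CRStab

/-! ### Sides and neighbours in a regular triangulation -/

namespace CRStab
namespace Triangle

theorem mid_mem_side (K : Triangle) (i : Fin 3) : K.mid i ∈ K.side i :=
  midpoint_mem_segment _ _

theorem side_subset_body (K : Triangle) (i : Fin 3) : K.side i ⊆ K.body :=
  segment_subset_convexHull (Set.mem_range_self _) (Set.mem_range_self _)

theorem mid_mem_body (K : Triangle) (i : Fin 3) : K.mid i ∈ K.body :=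
  K.side_subset_body i (K.mid_mem_side i)

/-- A set of vertices whose convex hull contains the midpoint of a side contains both endpoints of
the side. -/
theorem endpoints_mem_of_mid_mem {K : Triangle} (hK : AffineIndependent ℝ K) {S : Set Plane}
    (hS : S ⊆ Set.range K) {i : Fin 3} (h : K.mid i ∈ convexHull ℝ S) :
    K (i + 1) ∈ S ∧ K (i + 2) ∈ S := by
  have hc := cross_ne_zero hK i
  rw [K.range_eq i] at hS
  constructor <;> by_contra hn
  -- Without this endpoint, `S` spans at most another side, and the midpoint has half the signed
  -- area of `K` relative to that side, which is nonzero.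
  · have hsub : S ⊆ {K (i + 2), K i} := fun p hp => by
      rcases hS hp with rfl | h | h
      · exact absurd hp hn
      · exact Or.inl h
      · exact Or.inr h
    have := convexHull_mono hsub h
    rw [convexHull_pair] at this
    have h0 := cross_eq_zero_of_mem_segment this
    rw [mid, cross_midpoint] at h0
    exact hc (by linarith)
  · have hsub : S ⊆ {K (i + 1), K i} := fun p hp => by
      rcases hS hp with h | rfl | h
      · exact Or.inl h
      · exact absurd hp hn
      · exact Or.inr h
    have := convexHull_mono hsub h
    rw [convexHull_pair] at this
    have h0 := cross_eq_zero_of_mem_segment this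
    rw [mid, midpoint_comm, cross_midpoint] at h0
    have : cross (K (i + 2)) (K (i + 1)) (K i) = -cross (K (i + 1)) (K (i + 2)) (K i) :=
      cross_swap _ _ _
    exact hc (by linarith)

theorem side_injective {K : Triangle} (hK : AffineIndependent ℝ K) :
    Function.Injective K.side := by
  intro i j h
  have hm : K.mid i ∈ convexHull ℝ {K (j + 1), K (j + 2)} := by
    rw [convexHull_pair]
    change K.mid i ∈ K.side j
    exact h ▸ K.mid_mem_side i
  have := endpoints_mem_of_mid_mem hK (by
    rintro _ (rfl | rfl) <;> exact Set.mem_range_self _) hm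
  simp only [Set.mem_insert_iff, Set.mem_singleton_iff, hK.injective.eq_iff] at this
  clear h hm
  revert i j
  decide

/-- Two different vertices of a triangle are the endpoints of one of its sides. -/
theorem exists_endpoints {K : Triangle} {a b : Plane} (hab : a ≠ b) (ha : a ∈ Set.range K)
    (hb : b ∈ Set.range K) :
    ∃ j, (a = K (j + 1) ∧ b = K (j + 2)) ∨ (a = K (j + 2) ∧ b = K (j + 1)) := by
  obtain ⟨k, rfl⟩ := ha
  obtain ⟨l, rfl⟩ := hb
  have hkl : k ≠ l := fun h => hab (h ▸ rfl)
  have : ∃ j : Fin 3, (k = j + 1 ∧ l = j + 2) ∨ (k = j + 2 ∧ l = j + 1) := by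
    clear hab
    revert k l; decide
  obtain ⟨j, ⟨rfl, rfl⟩ | ⟨rfl, rfl⟩⟩ := this
  · exact ⟨j, Or.inl ⟨rfl, rfl⟩⟩
  · exact ⟨j, Or.inr ⟨rfl, rfl⟩⟩

end Triangle

/-- Two triangles on the same side of a common edge overlap outside this edge. -/
theorem exists_mem_inter_of_cross_mul_pos {a b c c' : Plane} {s s' : Set Plane}
    (h : 0 < cross a b c * cross a b c') (ha : a ∈ s) (hb : b ∈ s) (hc : c ∈ s)
    (ha' : a ∈ s') (hb' : b ∈ s') (hc' : c' ∈ s') :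
    ∃ q ∈ convexHull ℝ s ∩ convexHull ℝ s', cross a b q ≠ 0 := by
  have hn : cross a b c ≠ 0 := left_ne_zero_of_mul h.ne'
  have hn' : cross a b c' ≠ 0 := right_ne_zero_of_mul h.ne'
  -- Barycentric coordinates of `c` with respect to `a`, `b`, `c'`, by Cramer's rule; equal
  -- orientation means `γ > 0`.
  set α := cross c b c' / cross a b c' with hα
  set β := cross a c c' / cross a b c' with hβ
  set γ := cross a b c / cross a b c' with hγ
  have hγ0 : 0 < γ := by
    have : γ = cross a b c * cross a b c' / cross a b c' ^ 2 := by rw [hγ]; field_simp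
    rw [this]; positivity
  have hsum : α + β + γ = 1 := by
    rw [hα, hβ, hγ, ← add_div, ← add_div, div_eq_one_iff_eq hn']
    unfold cross; ring
  have hcomb : c = α • a + β • b + γ • c' := by
    ext i
    simp only [PiLp.add_apply, PiLp.smul_apply, smul_eq_mul, hα, hβ, hγ]
    field_simp
    unfold cross
    fin_cases i <;> simp <;> ring
  -- The witness moves from the midpoint of `ab` towards `c`, so little that its coordinates with
  -- respect to `a`, `b`, `c'` stay nonnegative.
  set t : ℝ := 1 / (2 * (1 + |α| + |β|)) with ht
  have ht0 : 0 < t := by positivity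
  have ht1 : t * (2 * (1 + |α| + |β|)) = 1 := by rw [ht]; field_simp
  have hα1 : 0 ≤ t * (α + |α|) := mul_nonneg ht0.le (by linarith [neg_abs_le α])
  have hβ1 : 0 ≤ t * (β + |β|) := mul_nonneg ht0.le (by linarith [neg_abs_le β])
  have hα2 : 0 ≤ t * |α| := by positivity
  have hβ2 : 0 ≤ t * |β| := by positivity
  refine ⟨((1 - t) / 2) • a + ((1 - t) / 2) • b + t • c, ⟨?_, ?_⟩, ?_⟩
  · exact combo_mem_convexHull ha hb hc (by linarith) (by linarith) ht0.le (by ring)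
  · have : ((1 - t) / 2) • a + ((1 - t) / 2) • b + t • c =
        ((1 - t) / 2 + t * α) • a + ((1 - t) / 2 + t * β) • b + (t * γ) • c' := by
      conv_lhs => rw [hcomb]
      module
    rw [this]
    refine combo_mem_convexHull ha' hb' hc' (by linarith) (by linarith) (by positivity) ?_
    linear_combination t * hsum
  · rw [cross_combo _ _ _ (by ring)]
    exact mul_ne_zero ht0.ne' hn

section Regular

variable {Ω : Set Plane} {T : Finset Triangle}

theorem IsRegularTriangulation.not_range_subset (hT : IsRegularTriangulation Ω T)
    {K K' : Triangle} (hK : K ∈ T) (hK' : K' ∈ T) (hne : K ≠ K') :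
    ¬ Set.range K ⊆ Set.range K' := by
  intro h
  refine (hT.conforming K hK K' hK' hne).1 (Set.eq_of_subset_of_ncard_le h ?_ (Set.toFinite _))
  rw [Set.ncard_range_of_injective (hT.nondegenerate K hK).injective,
    Set.ncard_range_of_injective (hT.nondegenerate K' hK').injective]

theorem IsRegularTriangulation.not_body_subset (hT : IsRegularTriangulation Ω T)
    {K K' : Triangle} (hK : K ∈ T) (hK' : K' ∈ T) (hne : K ≠ K') :
    ¬ K.body ⊆ K'.body := by
  intro h
  apply hT.not_range_subset hK hK' hne
  have hKi := hT.nondegenerate K hK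
  have key : ∀ i, K (i + 1) ∈ Set.range K' := fun i => by
    have : K.mid i ∈ K.body ∩ K'.body := ⟨K.mid_mem_body i, h (K.mid_mem_body i)⟩
    rw [(hT.conforming K hK K' hK' hne).2] at this
    exact (Triangle.endpoints_mem_of_mid_mem hKi Set.inter_subset_left this).1.2
  rintro _ ⟨i, rfl⟩
  have := key (i - 1)
  rwa [sub_add_cancel] at this

/-- Another triangle that contains the midpoint of a side contains its endpoints as vertices. -/
theorem IsRegularTriangulation.endpoints_mem_of_mid_mem (hT : IsRegularTriangulation Ω T)
    {K K' : Triangle} (hK : K ∈ T) (hK' : K' ∈ T) (hne : K' ≠ K) {i : Fin 3}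
    (h : K.mid i ∈ K'.body) : ∃ j, (K (i + 1) = K' (j + 1) ∧ K (i + 2) = K' (j + 2)) ∨
      (K (i + 1) = K' (j + 2) ∧ K (i + 2) = K' (j + 1)) := by
  have hKi := hT.nondegenerate K hK
  have : K.mid i ∈ K.body ∩ K'.body := ⟨K.mid_mem_body i, h⟩
  rw [(hT.conforming K hK K' hK' hne.symm).2] at this
  have := Triangle.endpoints_mem_of_mid_mem hKi Set.inter_subset_left this
  refine Triangle.exists_endpoints (hKi.injective.ne ?_) this.1.2 this.2.2
  simp

/-- Conformity reduces sharing a side to containing one point, its midpoint. This form passes to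
larger triangles and to closures. -/
theorem IsRegularTriangulation.mem_neighbours_iff (hT : IsRegularTriangulation Ω T)
    {K K' : Triangle} (hK : K ∈ T) {i : Fin 3} :
    K' ∈ neighbours T K i ↔ K' ∈ T ∧ K' ≠ K ∧ K.mid i ∈ K'.body := by
  simp only [neighbours, Finset.mem_filter]
  refine and_congr_right fun hK' => and_congr_right fun hne => ⟨?_, fun h => ?_⟩
  · rintro ⟨j, hj⟩
    exact K'.side_subset_body j (hj ▸ K.mid_mem_side i)
  · obtain ⟨j, ⟨h1, h2⟩ | ⟨h1, h2⟩⟩ := hT.endpoints_mem_of_mid_mem hK hK' hne h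
    · exact ⟨j, by rw [Triangle.side, Triangle.side, h1, h2]⟩
    · exact ⟨j, by rw [Triangle.side, Triangle.side, h1, h2, segment_symm]⟩

/-- Two triangles with a common edge lie on different sides of it. -/
theorem IsRegularTriangulation.cross_mul_neg (hT : IsRegularTriangulation Ω T)
    {K K' : Triangle} (hK : K ∈ T) (hK' : K' ∈ T) (hne : K ≠ K') {a b : Plane} (hab : a ≠ b)
    (ha : a ∈ Set.range K) (hb : b ∈ Set.range K) (ha' : a ∈ Set.range K')
    (hb' : b ∈ Set.range K') :
    ∃ c ∈ Set.range K, ∃ c' ∈ Set.range K', Set.range K = {a, b, c} ∧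
      Set.range K' = {a, b, c'} ∧ cross a b c * cross a b c' < 0 := by
  have third : ∀ L ∈ T, a ∈ Set.range L → b ∈ Set.range L →
      ∃ c ∈ Set.range L, Set.range L = {a, b, c} ∧ cross a b c ≠ 0 := by
    intro L hL ha hb
    have hc := fun j => Triangle.cross_ne_zero (hT.nondegenerate L hL) j
    obtain ⟨j, ⟨rfl, rfl⟩ | ⟨rfl, rfl⟩⟩ := Triangle.exists_endpoints hab ha hb
    · exact ⟨L j, Set.mem_range_self _, L.range_eq j, hc j⟩
    · refine ⟨L j, Set.mem_range_self _, ?_, ?_⟩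
      · rw [L.range_eq j, Set.insert_comm]
      · rw [cross_swap]; exact neg_ne_zero.2 (hc j)
  obtain ⟨c, hc, hr, hn⟩ := third K hK ha hb
  obtain ⟨c', hc', hr', hn'⟩ := third K' hK' ha' hb'
  refine ⟨c, hc, c', hc', hr, hr', ?_⟩
  by_contra! h
  have hpos := lt_of_le_of_ne h (mul_ne_zero hn hn').symm
  obtain ⟨q, hq, hq0⟩ := exists_mem_inter_of_cross_mul_pos hpos ha hb hc ha' hb' hc'
  change q ∈ K.body ∩ K'.body at hq
  rw [(hT.conforming K hK K' hK' hne).2] at hq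
  have hsub : Set.range K ∩ Set.range K' ⊆ {a, b} := by
    rintro p ⟨hp, hp'⟩
    rw [hr] at hp
    rcases hp with h | h | h
    · exact Or.inl h
    · exact Or.inr h
    · refine absurd ?_ (hT.not_range_subset hK hK' hne)
      rw [hr]
      have hpc : p = c := h
      rintro _ (rfl | rfl | rfl) <;> first | assumption | exact hpc ▸ hp'
  have := convexHull_mono hsub hq
  rw [convexHull_pair] at this
  exact hq0 (cross_eq_zero_of_mem_segment this)

/-- A side belongs to at most two triangles. -/
theorem IsRegularTriangulation.eq_of_mem_neighbours (hT : IsRegularTriangulation Ω T)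
    {K L M : Triangle} (hK : K ∈ T) {i : Fin 3} (hL : L ∈ neighbours T K i)
    (hM : M ∈ neighbours T K i) : L = M := by
  by_contra hLM
  rw [hT.mem_neighbours_iff hK] at hL hM
  obtain ⟨hLT, hLK, hL⟩ := hL
  obtain ⟨hMT, hMK, hM⟩ := hM
  have hab : K (i + 1) ≠ K (i + 2) := (hT.nondegenerate K hK).injective.ne (by simp)
  have mem : ∀ N ∈ T, N ≠ K → K.mid i ∈ N.body →
      K (i + 1) ∈ Set.range N ∧ K (i + 2) ∈ Set.range N := by
    intro N hN hNK h
    obtain ⟨j, ⟨h1, h2⟩ | ⟨h1, h2⟩⟩ := hT.endpoints_mem_of_mid_mem hK hN hNK h <;>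
    · rw [h1, h2]; exact ⟨Set.mem_range_self _, Set.mem_range_self _⟩
  obtain ⟨l1, l2⟩ := mem L hLT hLK hL
  obtain ⟨m1, m2⟩ := mem M hMT hMK hM
  have k1 := Set.mem_range_self (f := K) (i + 1)
  have k2 := Set.mem_range_self (f := K) (i + 2)
  have uniq : ∀ N : Triangle, ∀ c c', Set.range N = {K (i + 1), K (i + 2), c} →
      Set.range N = {K (i + 1), K (i + 2), c'} → cross (K (i + 1)) (K (i + 2)) c ≠ 0 → c = c' := by
    intro N c c' h h' hc
    have : c ∈ ({K (i + 1), K (i + 2), c'} : Set Plane) := by rw [← h', h]; simp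
    rcases this with h | h | h
    · rw [h] at hc; unfold cross at hc; exact absurd (by ring) hc
    · rw [h] at hc; unfold cross at hc; exact absurd (by ring) hc
    · exact h
  -- Three triangles at one edge would have third vertices pairwise on opposite sides of its line,
  -- but three reals cannot have pairwise negative products.
  obtain ⟨c, -, d, -, hc, hd, h1⟩ := hT.cross_mul_neg hK hLT hLK.symm hab k1 k2 l1 l2
  obtain ⟨c₁, -, e, -, hc₁, he, h2⟩ := hT.cross_mul_neg hK hMT hMK.symm hab k1 k2 m1 m2
  obtain ⟨d₁, -, e₁, -, hd₁, he₁, h3⟩ := hT.cross_mul_neg hLT hMT hLM hab l1 l2 m1 m2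
  obtain rfl := uniq K c c₁ hc hc₁ (left_ne_zero_of_mul h1.ne)
  obtain rfl := uniq L d d₁ hd hd₁ (right_ne_zero_of_mul h1.ne)
  obtain rfl := uniq M e e₁ he he₁ (right_ne_zero_of_mul h2.ne)
  nlinarith [mul_neg_of_pos_of_neg (mul_pos_of_neg_of_neg h1 h2) h3,
    sq_nonneg (cross (K (i + 1)) (K (i + 2)) c * cross (K (i + 1)) (K (i + 2)) d *
      cross (K (i + 1)) (K (i + 2)) e)]

end Regular
end CRStab

/-! ### Interiors, refinement and the domain -/

namespace CRStab

namespace Triangle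

theorem convex_body (K : Triangle) : Convex ℝ K.body := convex_convexHull ℝ _

theorem isCompact_body (K : Triangle) : IsCompact K.body :=
  (Set.finite_range K).isCompact_convexHull ℝ

theorem isClosed_body (K : Triangle) : IsClosed K.body := K.isCompact_body.isClosed

theorem volume_body_lt_top (K : Triangle) : volume K.body < ⊤ := K.isCompact_body.measure_lt_top

theorem volume_interior_body (K : Triangle) : volume (interior K.body) = volume K.body :=
  measure_interior_of_null_frontier (K.convex_body.addHaar_frontier volume)

theorem interior_body_nonempty {K : Triangle} (hK : AffineIndependent ℝ K) :
    (interior K.body).Nonempty := by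
  by_contra h
  have := area_pos hK
  rw [area, measureReal_def, ← volume_interior_body, Set.not_nonempty_iff_eq_empty.1 h] at this
  simp at this

theorem closure_interior_body {K : Triangle} (hK : AffineIndependent ℝ K) :
    closure (interior K.body) = K.body := by
  rw [K.convex_body.closure_interior_eq_closure_of_nonempty_interior (interior_body_nonempty hK),
    K.isClosed_body.closure_eq]

theorem child₁_body_subset (K : Triangle) : K.child₁.body ⊆ K.body := by
  apply convexHull_min _ K.convex_body
  have h : ∀ i, K i ∈ K.body := fun i => subset_convexHull ℝ _ (Set.mem_range_self i)
  rintro _ ⟨i, rfl⟩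
  fin_cases i
  · exact h 0
  · exact K.convex_body.midpoint_mem (h 0) (h 2)
  · exact h 1

theorem child₂_body_subset (K : Triangle) : K.child₂.body ⊆ K.body := by
  apply convexHull_min _ K.convex_body
  have h : ∀ i, K i ∈ K.body := fun i => subset_convexHull ℝ _ (Set.mem_range_self i)
  rintro _ ⟨i, rfl⟩
  fin_cases i
  · exact h 2
  · exact K.convex_body.midpoint_mem (h 0) (h 2)
  · exact h 1

end Triangle

theorem interior_segment_eq_empty {a b c : Plane} (h : cross a b c ≠ 0) :
    interior (segment ℝ a b) = ∅ := by
  by_contra hne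
  rw [← ne_eq, ← Set.nonempty_iff_ne_empty, ← convexHull_pair,
    interior_convexHull_nonempty_iff_affineSpan_eq_top] at hne
  have hc : c ∈ affineSpan ℝ {a, b} := hne ▸ AffineSubspace.mem_top ℝ Plane c
  obtain ⟨r, rfl⟩ := mem_affineSpan_pair_iff_exists_lineMap_eq.1 hc
  apply h
  rw [AffineMap.lineMap_apply_module]
  simp only [cross, PiLp.add_apply, PiLp.smul_apply, smul_eq_mul]
  ring

theorem exists_body_subset_of_refinement {T T' : Finset Triangle}
    (h : Relation.ReflTransGen BisectStep T T') {K' : Triangle} (hK' : K' ∈ T') :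
    ∃ K ∈ T, K'.body ⊆ K.body := by
  classical
  induction h generalizing K' with
  | refl => exact ⟨K', hK', subset_rfl⟩
  | tail _ hstep ih =>
    obtain ⟨L, hL, rfl⟩ := hstep
    simp only [Finset.mem_union, Finset.mem_erase, Finset.mem_insert, Finset.mem_singleton] at hK'
    rcases hK' with ⟨-, hK'⟩ | rfl | rfl
    · exact ih hK'
    · obtain ⟨K, hK, hsub⟩ := ih hL
      exact ⟨K, hK, L.child₁_body_subset.trans hsub⟩
    · obtain ⟨K, hK, hsub⟩ := ih hL
      exact ⟨K, hK, L.child₂_body_subset.trans hsub⟩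

/-- A Lipschitz domain lies locally on one side of its boundary. -/
theorem IsLipschitzDomain.interior_closure {Ω : Set Plane} (hΩ : IsLipschitzDomain Ω) :
    interior (closure Ω) = Ω := by
  refine Set.Subset.antisymm (fun x hx => ?_) (interior_maximal subset_closure hΩ.isOpen)
  by_contra hxΩ
  have hfr : x ∈ frontier Ω := by
    rw [hΩ.isOpen.frontier_eq]
    exact ⟨interior_subset hx, hxΩ⟩
  obtain ⟨e, r, L, φ, hr, hφ, hΩe⟩ := hΩ.lipschitz_boundary x hfr
  have hx0 : e x 1 ≤ φ (e x 0) := by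
    by_contra! h
    exact hxΩ ((hΩe x (Metric.mem_ball_self hr)).2 h)
  obtain ⟨ε, hε, hball⟩ := Metric.isOpen_iff.1 (isOpen_interior.inter Metric.isOpen_ball)
    x ⟨hx, Metric.mem_ball_self hr⟩
  -- Lowering `x` gives a point strictly below the graph: still in the closure of `Ω`, yet with a
  -- neighbourhood disjoint from `Ω`.
  set y := e.symm (e x - (ε / 2) • EuclideanSpace.single 1 1) with hy
  have hey : e y = e x - (ε / 2) • EuclideanSpace.single 1 1 := by rw [hy, e.apply_symm_apply]
  have hyx : dist y x < ε := by
    rw [← e.dist_map, hey, dist_eq_norm, sub_sub_cancel_left, norm_neg, norm_smul]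
    simp [abs_of_pos hε, hε]
  obtain ⟨hyc, hyr⟩ := hball hyx
  have hopen : IsOpen (Metric.ball x r ∩ {z | e z 1 < φ (e z 0)}) := by
    refine Metric.isOpen_ball.inter (isOpen_lt ?_ (hφ.continuous.comp ?_)) <;>
    · have := e.continuous
      fun_prop
  obtain ⟨z, ⟨hzr, hz⟩, hzΩ⟩ := mem_closure_iff.1 (interior_subset hyc) _ hopen ⟨hyr, by
    simp only [Set.mem_ofPred_eq, hey]
    simp
    linarith⟩
  exact lt_asymm hz ((hΩe z hzr).1 hzΩ)

section Regular

variable {Ω : Set Plane} {T T' : Finset Triangle}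

theorem IsRegularTriangulation.disjoint_interior (hT : IsRegularTriangulation Ω T)
    {K K' : Triangle} (hK : K ∈ T) (hK' : K' ∈ T) (hne : K ≠ K') :
    Disjoint (interior K.body) (interior K'.body) := by
  rw [Set.disjoint_iff_inter_eq_empty, ← interior_inter, (hT.conforming K hK K' hK' hne).2]
  obtain ⟨_, ⟨i, rfl⟩, hi⟩ := Set.not_subset.1 (hT.not_range_subset hK hK' hne)
  have hsub : Set.range K ∩ Set.range K' ⊆ {K (i + 1), K (i + 2)} := by
    rintro p ⟨hp, hp'⟩
    rw [K.range_eq i] at hp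
    rcases hp with h | h | h
    · exact Or.inl h
    · exact Or.inr h
    · rw [Set.mem_singleton_iff] at h
      exact absurd (h ▸ hp') hi
  have := interior_mono (convexHull_mono (𝕜 := ℝ) hsub)
  rw [convexHull_pair,
    interior_segment_eq_empty (Triangle.cross_ne_zero (hT.nondegenerate K hK) i)] at this
  exact Set.subset_empty_iff.1 this

theorem IsRegularTriangulation.disjoint_interior_body (hT : IsRegularTriangulation Ω T)
    {K K' : Triangle} (hK : K ∈ T) (hK' : K' ∈ T) (hne : K ≠ K') :
    Disjoint (interior K.body) K'.body := by
  rw [← Triangle.closure_interior_body (hT.nondegenerate K' hK')]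
  exact (hT.disjoint_interior hK hK' hne).closure_right isOpen_interior

theorem IsRegularTriangulation.body_subset_closure (hT : IsRegularTriangulation Ω T)
    {K : Triangle} (hK : K ∈ T) : K.body ⊆ closure Ω := by
  rw [← hT.cover]
  exact Set.subset_biUnion_of_mem (u := fun K : Triangle => K.body) hK

theorem IsRegularTriangulation.interior_body_subset (hT : IsRegularTriangulation Ω T)
    (hΩ : IsLipschitzDomain Ω) {K : Triangle} (hK : K ∈ T) : interior K.body ⊆ Ω := by
  rw [← hΩ.interior_closure]
  exact interior_mono (hT.body_subset_closure hK)

theorem IsRegularTriangulation.nonempty (hT : IsRegularTriangulation Ω T)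
    (hΩ : IsLipschitzDomain Ω) : T.Nonempty := by
  rw [Finset.nonempty_iff_ne_empty]
  rintro rfl
  have := hT.cover
  simp only [Finset.notMem_empty, Set.iUnion_false, Set.iUnion_empty] at this
  exact (hΩ.isConnected.nonempty.closure.ne_empty) this.symm

/-- The coarse triangle around `K'` contains the midpoint of the side. It differs from `K`, as
otherwise two distinct triangles of `T'` would be nested. -/
theorem IsRegularTriangulation.exists_neighbour_superset (hT : IsRegularTriangulation Ω T)
    (hT' : IsRegularTriangulation Ω T') (href : Relation.ReflTransGen BisectStep T T')
    {K K' : Triangle} (hK : K ∈ T) (hKT' : K ∈ T') {i : Fin 3} (hK' : K' ∈ neighbours T' K i) :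
    ∃ L ∈ neighbours T K i, K'.body ⊆ L.body := by
  rw [hT'.mem_neighbours_iff hKT'] at hK'
  obtain ⟨h1, h2, h3⟩ := hK'
  obtain ⟨L, hL, hsub⟩ := exists_body_subset_of_refinement href h1
  refine ⟨L, (hT.mem_neighbours_iff hK).2 ⟨hL, ?_, hsub h3⟩, hsub⟩
  rintro rfl
  exact hT'.not_body_subset h1 hKT' h2 hsub

/-- Triangles of `T'` other than `K` cover the interior of the coarse neighbour. Their finite union
is closed, hence contains the midpoint of the side as well. -/
theorem IsRegularTriangulation.neighbours_nonempty (hT : IsRegularTriangulation Ω T)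
    (hT' : IsRegularTriangulation Ω T') {K : Triangle} (hK : K ∈ T) (hKT' : K ∈ T') {i : Fin 3}
    (h : (neighbours T K i).Nonempty) : (neighbours T' K i).Nonempty := by
  classical
  obtain ⟨L, hL⟩ := h
  obtain ⟨hLT, hLK, hm⟩ := (hT.mem_neighbours_iff hK).1 hL
  have hsub : interior L.body ⊆ ⋃ M ∈ T'.erase K, M.body := by
    intro x hx
    have hxΩ := hT.body_subset_closure hLT (interior_subset hx)
    rw [← hT'.cover] at hxΩ
    simp only [Set.mem_iUnion, exists_prop] at hxΩ ⊢
    obtain ⟨M, hM, hxM⟩ := hxΩ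
    refine ⟨M, Finset.mem_erase.2 ⟨?_, hM⟩, hxM⟩
    rintro rfl
    exact Set.disjoint_left.1 (hT.disjoint_interior_body hLT hK hLK) hx hxM
  have hcl : IsClosed (⋃ M ∈ T'.erase K, M.body) :=
    (T'.erase K).finite_toSet.isClosed_biUnion fun M _ => M.isClosed_body
  have := closure_minimal hsub hcl
  rw [Triangle.closure_interior_body (hT.nondegenerate L hLT)] at this
  have := this hm
  simp only [Set.mem_iUnion, exists_prop, Finset.mem_erase] at this
  obtain ⟨M, ⟨hMK, hM⟩, hmM⟩ := this
  exact ⟨M, (hT'.mem_neighbours_iff hKT').2 ⟨hM, hMK, hmM⟩⟩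

end Regular

/-! ### Piecewise gradients -/

theorem gradient_affineMap (φ : Plane →ᵃ[ℝ] ℝ) (x y : Plane) :
    gradient φ x = gradient φ y := by
  have h : ∀ z, fderiv ℝ φ z = φ.linear.toContinuousLinearMap := fun z => by
    have h1 : HasFDerivAt (fun w => φ.linear.toContinuousLinearMap w + φ 0)
        φ.linear.toContinuousLinearMap z :=
      (φ.linear.toContinuousLinearMap.hasFDerivAt).add_const _
    have h2 : (φ : Plane → ℝ) = fun w => φ.linear.toContinuousLinearMap w + φ 0 := φ.decomp
    rw [← h2] at h1
    exact h1.fderiv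
  rw [gradient, gradient, h, h]

section Gradient

variable {Ω : Set Plane} {T T' : Finset Triangle}

theorem IsRegularTriangulation.pwGrad_eq (hT : IsRegularTriangulation Ω T) (v : PiecewiseAffine)
    {K : Triangle} (hK : K ∈ T) {x : Plane} (hx : x ∈ interior K.body) :
    pwGrad T v x = gradient (v K) 0 := by
  rw [pwGrad, Finset.sum_eq_single_of_mem K hK, Set.indicator_of_mem hx,
    gradient_affineMap _ x 0]
  intro L hL hne
  exact Set.indicator_of_notMem
    (Set.disjoint_left.1 (hT.disjoint_interior hK hL hne.symm) hx) _

theorem memLp_pwGrad (T : Finset Triangle) (v : PiecewiseAffine) : MemLp (pwGrad T v) 2 := by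
  have : pwGrad T v = fun x => ∑ K ∈ T,
      (interior K.body).indicator (fun _ => gradient (v K) 0) x := by
    ext1 x
    refine Finset.sum_congr rfl fun K _ => ?_
    congr 1
    ext1 y
    exact gradient_affineMap _ _ _
  rw [this]
  refine memLp_finsetSum _ fun K _ => ?_
  refine memLp_indicator_const _ isOpen_interior.measurableSet _ (Or.inr ?_)
  rw [K.volume_interior_body]
  exact K.volume_body_lt_top.ne

/-- The sum of the local contributions of the triangles of `T'` is at most the integral over `Ω`. -/
theorem IsRegularTriangulation.sum_area_mul_le (hT' : IsRegularTriangulation Ω T')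
    (hΩ : IsLipschitzDomain Ω) (T : Finset Triangle) (u u' : PiecewiseAffine)
    (g : Triangle → Plane)
    (hg : ∀ K ∈ T', ∀ x ∈ interior K.body, pwGrad T u x - pwGrad T' u' x = g K) :
    ∑ K ∈ T', K.area * ‖g K‖ ^ 2 ≤ ∫ x in Ω, ‖pwGrad T u x - pwGrad T' u' x‖ ^ 2 := by
  have hint : Integrable fun x => ‖pwGrad T u x - pwGrad T' u' x‖ ^ 2 :=
    ((memLp_pwGrad T u).sub (memLp_pwGrad T' u')).integrable_norm_pow two_ne_zero
  calc ∑ K ∈ T', K.area * ‖g K‖ ^ 2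
      = ∑ K ∈ T', ∫ x in interior K.body, ‖pwGrad T u x - pwGrad T' u' x‖ ^ 2 := by
        refine Finset.sum_congr rfl fun K hK => ?_
        rw [setIntegral_congr_fun isOpen_interior.measurableSet
          (g := fun _ => ‖g K‖ ^ 2) fun x hx => by simp only [hg K hK x hx], setIntegral_const,
          measureReal_def, K.volume_interior_body, smul_eq_mul, Triangle.area, measureReal_def]
    _ = ∫ x in ⋃ K ∈ T', interior K.body, ‖pwGrad T u x - pwGrad T' u' x‖ ^ 2 := by
        refine (integral_biUnion_finset T' (fun K _ => isOpen_interior.measurableSet) ?_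
          fun K _ => hint.integrableOn).symm
        exact fun K hK K' hK' hne => hT'.disjoint_interior hK hK' hne
    _ ≤ _ := by
        refine setIntegral_mono_set hint.integrableOn (.of_forall fun x => by positivity) ?_
        exact .of_forall (Set.iUnion₂_subset fun K hK => hT'.interior_body_subset hΩ hK)

end Gradient
end CRStab

/-! ### Comparison of the estimators -/

namespace CRStab

/-- The reverse triangle inequality for vectors with the common extra coordinate `√c`, indexed by
`none`, which cancels in the difference. -/
theorem abs_sqrt_add_sum_sq_sub_le {ι : Type*} [Fintype ι] {c : ℝ} (hc : 0 ≤ c) (a b : ι → ℝ) :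
    |√(c + ∑ i, a i ^ 2) - √(c + ∑ i, b i ^ 2)| ≤ √(∑ i, (a i - b i) ^ 2) := by
  have h := abs_norm_sub_norm_le
    (WithLp.toLp 2 (fun o : Option ι => o.elim √c a) : EuclideanSpace ℝ (Option ι))
    (WithLp.toLp 2 (fun o : Option ι => o.elim √c b))
  simpa [EuclideanSpace.norm_eq, Fintype.sum_option, Real.sq_sqrt hc] using h

theorem tangentialJump_eq (T : Finset Triangle) (u : PiecewiseAffine) (K : Triangle) (i : Fin 3)
    (x : Plane) : tangentialJump T u K i x = inner ℝ (gradient (u K) 0) (K.tangent i) -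
      ∑ K' ∈ neighbours T K i, inner ℝ (gradient (u K') 0) (K.tangent i) := by
  simp only [tangentialJump, gradient_affineMap _ x 0]

theorem etaSq_eq (f : Plane → ℝ) (T : Finset Triangle) (u : PiecewiseAffine) (K : Triangle) :
    etaSq f T u K = K.area * (∫ x in K.body, f x ^ 2) +
      ∑ i, (√(√K.area * dist (K (i + 1)) (K (i + 2))) * tangentialJump T u K i 0) ^ 2 := by
  rw [etaSq, Finset.mul_sum]
  congr 1
  refine Finset.sum_congr rfl fun i _ => ?_
  have : ∀ x, tangentialJump T u K i x = tangentialJump T u K i 0 := fun x => by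
    rw [tangentialJump_eq, tangentialJump_eq]
  simp_rw [this]
  rw [setIntegral_const, measureReal_def, Triangle.side, hausdorffMeasure_segment, edist_dist,
    ENNReal.toReal_ofReal dist_nonneg, mul_pow, Real.sq_sqrt (by positivity), smul_eq_mul, mul_assoc]

theorem area_nonneg (K : Triangle) : 0 ≤ K.area := measureReal_nonneg

theorem abs_eta_sub_eta_le (f : Plane → ℝ) (T T' U : Finset Triangle) (u u' : PiecewiseAffine) :
    |eta f T u U - eta f T' u' U| ≤ √(∑ K ∈ U, ∑ i, √K.area * dist (K (i + 1)) (K (i + 2)) *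
      (tangentialJump T u K i 0 - tangentialJump T' u' K i 0) ^ 2) := by
  have hc : 0 ≤ ∑ K ∈ U, K.area * ∫ x in K.body, f x ^ 2 :=
    Finset.sum_nonneg fun K _ =>
      mul_nonneg (area_nonneg K) (integral_nonneg fun x => sq_nonneg _)
  have h := abs_sqrt_add_sum_sq_sub_le hc
    (fun p : U × Fin 3 => √(√p.1.1.area * dist (p.1.1 (p.2 + 1)) (p.1.1 (p.2 + 2))) *
      tangentialJump T u p.1.1 p.2 0)
    (fun p : U × Fin 3 => √(√p.1.1.area * dist (p.1.1 (p.2 + 1)) (p.1.1 (p.2 + 2))) *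
      tangentialJump T' u' p.1.1 p.2 0)
  have hsq : ∀ p : U × Fin 3,
      √(√p.1.1.area * dist (p.1.1 (p.2 + 1)) (p.1.1 (p.2 + 2))) ^ 2 =
        √p.1.1.area * dist (p.1.1 (p.2 + 1)) (p.1.1 (p.2 + 2)) :=
    fun p => Real.sq_sqrt (by positivity)
  have hs : ∀ φ : Triangle → Fin 3 → ℝ,
      ∑ p : U × Fin 3, φ p.1.1 p.2 = ∑ K ∈ U, ∑ i, φ K i := fun φ => by
    rw [Fintype.sum_prod_type, ← Finset.sum_coe_sort U]
  simp_rw [← mul_sub, mul_pow _ (_ - _), hsq] at h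
  rw [hs fun K i => (√(√K.area * dist (K (i + 1)) (K (i + 2))) * tangentialJump T u K i 0) ^ 2,
    hs fun K i => (√(√K.area * dist (K (i + 1)) (K (i + 2))) * tangentialJump T' u' K i 0) ^ 2,
    hs fun K i => √K.area * dist (K (i + 1)) (K (i + 2)) *
      (tangentialJump T u K i 0 - tangentialJump T' u' K i 0) ^ 2,
    ← Finset.sum_add_distrib, ← Finset.sum_add_distrib] at h
  simpa only [eta, etaSq_eq] using h

theorem Triangle.inner_tangent_sq_le (K : Triangle) (i : Fin 3) (v : Plane) :
    inner ℝ v (K.tangent i) ^ 2 ≤ ‖v‖ ^ 2 := by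
  have ht : ‖K.tangent i‖ ≤ 1 := by
    rw [Triangle.tangent, norm_smul, norm_inv, Real.norm_of_nonneg dist_nonneg, dist_comm,
      dist_eq_norm]
    -- A side of length 0 is covered too, as `0⁻¹ = 0`.
    exact inv_mul_le_one
  have := abs_real_inner_le_norm v (K.tangent i)
  rw [← sq_abs]
  gcongr
  nlinarith [norm_nonneg v]

section Regular

variable {Ω : Set Plane} {T T' : Finset Triangle}

/-- Every triangle has at most three neighbours. -/
theorem IsRegularTriangulation.sum_neighbours_le (hT : IsRegularTriangulation Ω T)
    {a : Triangle → ℝ} (ha : ∀ K, 0 ≤ a K) :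
    ∑ K ∈ T, ∑ i, ∑ K' ∈ neighbours T K i, a K' ≤ 3 * ∑ K ∈ T, a K := by
  classical
  rw [← Finset.sum_product' T Finset.univ fun K i => ∑ K' ∈ neighbours T K i, a K',
    Finset.sum_comm' (s' := fun K' => {p ∈ T ×ˢ Finset.univ | K' ∈ neighbours T p.1 p.2})
      (t' := T), Finset.mul_sum]
  · refine Finset.sum_le_sum fun L hL => ?_
    rw [Finset.sum_const, nsmul_eq_mul]
    refine mul_le_mul_of_nonneg_right ?_ (ha L)
    have hex : ∀ p : Triangle × Fin 3, L ∈ neighbours T p.1 p.2 →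
        ∃ j, L.side j = p.1.side p.2 := fun p hp => (Finset.mem_filter.1 hp).2.2
    -- `g` sends a pair `(K, i)` with neighbour `L` to the matching side of `L`. It is injective
    -- because at most one other triangle lies at each side of `L`.
    choose! g hg using hex
    have hcard := Finset.card_le_card_of_injOn (t := Finset.univ) g
      (s := {p ∈ T ×ˢ Finset.univ | L ∈ neighbours T p.1 p.2}) (fun _ _ => Finset.mem_univ _) ?_
    · simpa using (Nat.cast_le (α := ℝ)).2 hcard
    rintro ⟨K, i⟩ hK ⟨M, j⟩ hM hKM
    simp only [Finset.coe_filter, Finset.mem_product, Finset.mem_univ, and_true,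
      Set.mem_ofPred_eq] at hK hM
    have gK : L.side (g (K, i)) = K.side i := hg (K, i) hK.2
    have gM : L.side (g (M, j)) = M.side j := hg (M, j) hM.2
    rw [← hKM] at gM
    generalize g (K, i) = k at gK gM
    have mK : K ∈ neighbours T L k :=
      Finset.mem_filter.2 ⟨hK.1, (Finset.mem_filter.1 hK.2).2.1.symm, i, gK.symm⟩
    have mM : M ∈ neighbours T L k :=
      Finset.mem_filter.2 ⟨hM.1, (Finset.mem_filter.1 hM.2).2.1.symm, j, gM.symm⟩
    obtain rfl : K = M := hT.eq_of_mem_neighbours hL mK mM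
    rw [Triangle.side_injective (hT.nondegenerate K hK.1) (gK.symm.trans gM)]
  · rintro ⟨K, i⟩ K'
    simp only [Finset.mem_product, Finset.mem_univ, and_true, Finset.mem_filter]
    have : K' ∈ neighbours T K i → K' ∈ T := fun h => (Finset.mem_filter.1 h).1
    tauto

/-- `g K'` is the value of `∇_NC (u - u')` on `K'`. Evaluating `pwGrad` at an interior point shows
that it does not depend on the choice of `L`. -/
theorem IsRegularTriangulation.exists_gradient_diff (hT : IsRegularTriangulation Ω T)
    (hT' : IsRegularTriangulation Ω T') (u u' : PiecewiseAffine) :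
    ∃ g : Triangle → Plane, ∀ K' ∈ T', ∀ L ∈ T, K'.body ⊆ L.body →
      gradient (u L) 0 - gradient (u' K') 0 = g K' := by
  have : ∀ K' ∈ T', ∃ v, ∀ L ∈ T, K'.body ⊆ L.body →
      gradient (u L) 0 - gradient (u' K') 0 = v := fun K' hK' => by
    obtain ⟨x, hx⟩ := Triangle.interior_body_nonempty (hT'.nondegenerate K' hK')
    refine ⟨pwGrad T u x - gradient (u' K') 0, fun L hL hsub => ?_⟩
    rw [hT.pwGrad_eq u hL (interior_mono hsub hx)]
  choose! g hg using this
  exact ⟨g, hg⟩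

theorem IsRegularTriangulation.tangentialJump_sub_sq_le (hT : IsRegularTriangulation Ω T)
    (hT' : IsRegularTriangulation Ω T') (href : Relation.ReflTransGen BisectStep T T')
    {u u' : PiecewiseAffine} {g : Triangle → Plane}
    (hg : ∀ K' ∈ T', ∀ L ∈ T, K'.body ⊆ L.body → gradient (u L) 0 - gradient (u' K') 0 = g K')
    {K : Triangle} (hK : K ∈ T) (hKT' : K ∈ T') (i : Fin 3) :
    (tangentialJump T u K i 0 - tangentialJump T' u' K i 0) ^ 2 ≤
      2 * (‖g K‖ ^ 2 + ∑ K' ∈ neighbours T' K i, ‖g K'‖ ^ 2) := by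
  rw [tangentialJump_eq, tangentialJump_eq]
  have hKt := K.inner_tangent_sq_le i (g K)
  have gK := hg K hKT' K hK subset_rfl
  rw [← gK, inner_sub_left] at hKt
  rw [← gK]
  rcases (neighbours T' K i).eq_empty_or_nonempty with he | ⟨M, hM⟩
  · have he' : neighbours T K i = ∅ := by
      by_contra h
      exact (hT.neighbours_nonempty hT' hK hKT' (Finset.nonempty_iff_ne_empty.2 h)).ne_empty he
    rw [he, he', Finset.sum_empty, Finset.sum_empty, Finset.sum_empty, sub_zero, sub_zero]
    nlinarith [norm_nonneg (gradient (u K) 0 - gradient (u' K) 0)]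
  · obtain ⟨L, hL, hsub⟩ := hT.exists_neighbour_superset hT' href hK hKT' hM
    have e' : neighbours T' K i = {M} := Finset.eq_singleton_iff_unique_mem.2
      ⟨hM, fun N hN => hT'.eq_of_mem_neighbours hKT' hN hM⟩
    have e : neighbours T K i = {L} := Finset.eq_singleton_iff_unique_mem.2
      ⟨hL, fun N hN => hT.eq_of_mem_neighbours hK hN hL⟩
    have hMt := K.inner_tangent_sq_le i (g M)
    have gM := hg M (Finset.mem_filter.1 hM).1 L (Finset.mem_filter.1 hL).1 hsub
    rw [← gM, inner_sub_left] at hMt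
    rw [e, e', Finset.sum_singleton, Finset.sum_singleton, Finset.sum_singleton, ← gM]
    set a := inner ℝ (gradient (u K) 0) (K.tangent i)
    set b := inner ℝ (gradient (u' K) 0) (K.tangent i)
    set c := inner ℝ (gradient (u L) 0) (K.tangent i)
    set d := inner ℝ (gradient (u' M) 0) (K.tangent i)
    -- With `x = a - b` and `y = c - d`, this is `(x - y)² ≤ 2 (x² + y²)`.
    nlinarith [sq_nonneg ((a - b) + (c - d))]

theorem IsRegularTriangulation.sum_jump_sub_sq_le (hT : IsRegularTriangulation Ω T)
    (hT' : IsRegularTriangulation Ω T') (href : Relation.ReflTransGen BisectStep T T')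
    {ω : ℝ} (hω : 0 < ω) (hangle : ∀ K ∈ T', ∀ i, ω ≤ K.angle i)
    {u u' : PiecewiseAffine} {g : Triangle → Plane}
    (hg : ∀ K' ∈ T', ∀ L ∈ T, K'.body ⊆ L.body → gradient (u L) 0 - gradient (u' K') 0 = g K')
    {U : Finset Triangle} (hU : U ⊆ T) (hU' : U ⊆ T') :
    ∑ K ∈ U, ∑ i, √K.area * dist (K (i + 1)) (K (i + 2)) *
      (tangentialJump T u K i 0 - tangentialJump T' u' K i 0) ^ 2 ≤
    12 * (4 * Real.cot ω * (2 * Real.sin ω) ^ (-(1 / 2 : ℝ))) *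
      ∑ K ∈ T', K.area * ‖g K‖ ^ 2 := by
  set C := 4 * Real.cot ω * (2 * Real.sin ω) ^ (-(1 / 2 : ℝ)) with hCdef
  set a : Triangle → ℝ := fun K => K.area * ‖g K‖ ^ 2 with hadef
  have ha : ∀ K, 0 ≤ a K := fun K => mul_nonneg (area_nonneg K) (sq_nonneg _)
  have hw : ∀ K ∈ U, ∀ K' ∈ T', ∀ i j, K.side i = K'.side j →
      √K.area * dist (K (i + 1)) (K (i + 2)) ≤ C * K'.area := by
    intro K hK K' hK' i j h
    have := Triangle.sqrt_area_mul_dist_div_area_le (hT'.nondegenerate K (hU' hK))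
      (hT'.nondegenerate K' hK') hω (hangle K (hU' hK)) (hangle K' hK') h
    rwa [div_le_iff₀ (Triangle.area_pos (hT'.nondegenerate K' hK'))] at this
  have hterm : ∀ K ∈ U, ∀ i, √K.area * dist (K (i + 1)) (K (i + 2)) *
      (tangentialJump T u K i 0 - tangentialJump T' u' K i 0) ^ 2 ≤
      2 * C * (a K + ∑ K' ∈ neighbours T' K i, a K') := by
    intro K hK i
    have h0 : 0 ≤ √K.area * dist (K (i + 1)) (K (i + 2)) := by positivity
    refine (mul_le_mul_of_nonneg_left (hT.tangentialJump_sub_sq_le hT' href hg (hU hK) (hU' hK) i)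
      h0).trans ?_
    have h1 : √K.area * dist (K (i + 1)) (K (i + 2)) * ‖g K‖ ^ 2 ≤ C * a K := by
      rw [hadef, ← mul_assoc]
      exact mul_le_mul_of_nonneg_right (hw K hK K (hU' hK) i i rfl) (sq_nonneg _)
    have h2 : √K.area * dist (K (i + 1)) (K (i + 2)) * ∑ K' ∈ neighbours T' K i, ‖g K'‖ ^ 2 ≤
        C * ∑ K' ∈ neighbours T' K i, a K' := by
      rw [Finset.mul_sum, Finset.mul_sum]
      refine Finset.sum_le_sum fun K' hK' => ?_
      obtain ⟨hm, -, j, hj⟩ := Finset.mem_filter.1 hK'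
      rw [hadef, ← mul_assoc]
      exact mul_le_mul_of_nonneg_right (hw K hK K' hm i j hj.symm) (sq_nonneg _)
    linarith
  -- The sign of `C` is known only once some triangle has angles at least `ω`; with no triangle at
  -- all, both sides vanish.
  rcases U.eq_empty_or_nonempty with rfl | ⟨K₀, hK₀⟩
  · rcases T'.eq_empty_or_nonempty with rfl | ⟨K₁, hK₁⟩
    · simp
    · have h1 := Triangle.sin_pos_of_le_angle (hT'.nondegenerate K₁ hK₁) hω (hangle K₁ hK₁)
      have h2 := Triangle.cot_pos_of_le_angle (hT'.nondegenerate K₁ hK₁) hω (hangle K₁ hK₁)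
      have := Finset.sum_nonneg fun K (_ : K ∈ T') => ha K
      rw [Finset.sum_empty]
      positivity
  have hC : 0 ≤ C := by
    have h1 := Triangle.sin_pos_of_le_angle (hT'.nondegenerate K₀ (hU' hK₀)) hω (hangle K₀ (hU' hK₀))
    have h2 := Triangle.cot_pos_of_le_angle (hT'.nondegenerate K₀ (hU' hK₀)) hω (hangle K₀ (hU' hK₀))
    positivity
  calc _ ≤ ∑ K ∈ U, ∑ i, 2 * C * (a K + ∑ K' ∈ neighbours T' K i, a K') :=
        Finset.sum_le_sum fun K hK => Finset.sum_le_sum fun i _ => hterm K hK i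
    -- Adding the refined triangles costs nothing and makes the neighbour count over all of `T'`
    -- applicable.
    _ ≤ ∑ K ∈ T', ∑ i, 2 * C * (a K + ∑ K' ∈ neighbours T' K i, a K') := by
        refine Finset.sum_le_sum_of_subset_of_nonneg hU' fun K _ _ =>
          Finset.sum_nonneg fun i _ => mul_nonneg (by positivity) (add_nonneg (ha K) ?_)
        exact Finset.sum_nonneg fun K' _ => ha K'
    _ = 2 * C * (3 * ∑ K ∈ T', a K + ∑ K ∈ T', ∑ i, ∑ K' ∈ neighbours T' K i, a K') := by
        simp_rw [← Finset.mul_sum, Finset.sum_add_distrib]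
        rw [Finset.mul_sum T' a 3]
        simp
    _ ≤ 2 * C * (3 * ∑ K ∈ T', a K + 3 * ∑ K ∈ T', a K) := by
        gcongr
        exact hT'.sum_neighbours_le ha
    _ = 12 * C * ∑ K ∈ T', a K := by ring

end Regular

theorem abs_eta_sub_eta_le_delta {Ω : Set Plane} {T T' : Finset Triangle}
    (hΩ : IsLipschitzDomain Ω) (hT : IsRegularTriangulation Ω T)
    (hT' : IsRegularTriangulation Ω T') (href : Relation.ReflTransGen BisectStep T T')
    {ω : ℝ} (hω : 0 < ω) (hangle : ∀ K ∈ T', ∀ i, ω ≤ K.angle i)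
    (f : Plane → ℝ) (u u' : PiecewiseAffine) :
    |eta f T u (unrefined T T') - eta f T' u' (unrefined T T')| ≤
      Lambda₁ ω * delta Ω T T' u u' := by
  classical
  obtain ⟨g, hg⟩ := hT.exists_gradient_diff hT' u u'
  obtain ⟨K₁, hK₁⟩ := hT'.nonempty hΩ
  have hs := Triangle.sin_pos_of_le_angle (hT'.nondegenerate K₁ hK₁) hω (hangle K₁ hK₁)
  have hc := Triangle.cot_pos_of_le_angle (hT'.nondegenerate K₁ hK₁) hω (hangle K₁ hK₁)
  have hsum := hT'.sum_area_mul_le hΩ T u u' g fun K hK x hx => by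
    obtain ⟨L, hL, hsub⟩ := exists_body_subset_of_refinement href hK
    rw [hT.pwGrad_eq u hL (interior_mono hsub hx), hT'.pwGrad_eq u' hK hx, hg K hK L hL hsub]
  refine (abs_eta_sub_eta_le f T T' _ u u').trans ?_
  rw [Lambda₁, delta, ← Real.sqrt_mul (by positivity)]
  refine Real.sqrt_le_sqrt ((hT.sum_jump_sub_sq_le hT' href hω hangle hg (U := unrefined T T')
    (fun K hK => (Finset.mem_inter.1 hK).1) fun K hK => (Finset.mem_inter.1 hK).2).trans ?_)
  refine (mul_le_mul_of_nonneg_left hsum (by positivity)).trans_eq ?_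
  ring

end CRStab

theorem mainTheorem8
    (Ω : Set CRStab.Plane) (hΩ : CRStab.IsLipschitzDomain Ω)
    (f : CRStab.Plane → ℝ) (hf : MemLp f 2 (volume.restrict Ω))
    (T₀ : Finset CRStab.Triangle) (hT₀ : CRStab.IsRegularTriangulation Ω T₀)
    (T : Finset CRStab.Triangle) (hT : T ∈ CRStab.admissible Ω T₀)
    (T' : Finset CRStab.Triangle) (hT' : T' ∈ CRStab.admissible Ω T)
    (ω₀ : ℝ) (hω₀ : 0 < ω₀)
    (hangle : ∀ K ∈ T, ∀ i, ω₀ ≤ K.angle i) (hangle' : ∀ K ∈ T', ∀ i, ω₀ ≤ K.angle i) :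
    CRStab.cQuot T ≤ 2 * Real.cot ω₀ / Real.sin ω₀ ∧
    CRStab.cQuot T' ≤ 2 * Real.cot ω₀ / Real.sin ω₀ ∧
    ∀ u u' : CRStab.PiecewiseAffine,
      CRStab.IsCRSolution Ω f T u → CRStab.IsCRSolution Ω f T' u' →
      |CRStab.eta f T u (CRStab.unrefined T T') - CRStab.eta f T' u' (CRStab.unrefined T T')|
        ≤ CRStab.Lambda₁ ω₀ * CRStab.delta Ω T T' u u' :=
  ⟨CRStab.cQuot_le (hT.2.nonempty hΩ) hT.2.nondegenerate hω₀ hangle,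
    CRStab.cQuot_le (hT'.2.nonempty hΩ) hT'.2.nondegenerate hω₀ hangle',
    fun u u' _ _ => CRStab.abs_eta_sub_eta_le_delta hΩ hT.2 hT'.2 hT'.1 hω₀ hangle' f u u'⟩
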